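/- Let $\mathcal X$ be a set of examples; a dataset is a finite multiset of elements of $\mathcal X$. For datasets $D,D'$ let $|D\ominus D'|$ be the size of their (multiset) symmetric difference, i.e. the least number of insertions and deletions of single examples that turn $D$ into $D'$, and put $\mathcal B(D,r)=\{D' : |D\ominus D'|\le r\}$. Let $f$ map datasets to $\mathbb R^d$ with single-example $\ell_2$-sensitivity at most $1$, i.e. $\|f(D)-f(D')\|_2\le 1$ whenever $|D\ominus D'|=1$. Let $0\le q\le 1$ and $\sigma>0$. The sub-sampled Gaussian mechanism $\mathcal M$ keeps each record of its input $D$ independently with probability $q$ (Poisson subsampling) to obtain a sub-dataset $T$, and outputs $f(T)+\mathcal N(0,\sigma^2 I_d)$; thus \[ \mathcal M(D)=\sum_{T\subseteq D} q^{|T|}(1-q)^{|D|-|T|}\,\mathcal N(f(T),\sigma^2 I_d), \] where the sum runs over all $2^{|D|}$ subsets of the records of $D$. For $\alpha>1$ let $D_\alpha(P\|Q)=\frac1{\alpha-1}\log\int\left(\frac{dP}{dQ}\right)^{\alpha}dQ$ if $P\ll Q$, and $D_\alpha(P\|Q)=+\infty$ otherwise, be the Rényi divergence. For $\bar q\in[0,1]$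 and $\bar\sigma>0$ let \[ \mathrm{SG}(\alpha,\bar q,\bar\sigma)=\max\Big\{D_\alpha\big(\mathcal N(0,\bar\sigma^2)\,\big\|\,(1-\bar q)\mathcal N(0,\bar\sigma^2)+\bar q\,\mathcal N(1,\bar\sigma^2)\big),\; D_\alpha\big((1-\bar q)\mathcal N(0,\bar\sigma^2)+\bar q\,\mathcal N(1,\bar\sigma^2)\,\big\|\,\mathcal N(0,\bar\sigma^2)\big)\Big\}. \] **Theorem.** Let $r\ge 1$ be an integer and let $D_1,D_3$ be datasets with $D_3\in\mathcal B(D_1,r)$. Then for every $\alpha>1$, \[ D_\alpha\big(\mathcal M(D_1)\,\|\,\mathcal M(D_3)\big)\le \mathrm{SG}\Big(\alpha,\,1-(1-q)^r,\,\frac{\sigma}{r}\Big) \quad\text{and}\quad D_\alpha\big(\mathcal M(D_3)\,\|\,\mathcal M(D_1)\big)\le \mathrm{SG}\Big(\alpha,\,1-(1-q)^r,\,\frac{\sigma}{r}\Big). \] -/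

import Mathlib

open MeasureTheory ProbabilityTheory
open scoped ENNReal NNReal

noncomputable section

namespace SGM

/-- Add/remove distance between two datasets (finite multisets of examples): the size of their
symmetric difference, i.e. the least number of insertions and deletions of single examples
that turns one into the other. -/
def datasetDist {X : Type*} [DecidableEq X] (D D' : Multiset X) : ℕ :=
  (D - D').card + (D' - D).card

/-- The ball `B(D, r)`: all datasets that differ from `D` in at most `r` examples. -/
def datasetBall {X : Type*} [DecidableEq X] (D : Multiset X) (r : ℕ) : Set (Multiset X) :=
  {D' | datasetDist D D' ≤ r}

/-- Single-example `ℓ₂`-sensitivity of `f` at most `Δ`. -/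
def SensitivityLE {X : Type*} [DecidableEq X] {d : ℕ}
    (f : Multiset X → EuclideanSpace ℝ (Fin d)) (Δ : ℝ) : Prop :=
  ∀ D D' : Multiset X, datasetDist D D' = 1 → ‖f D - f D'‖ ≤ Δ

/-- The isotropic Gaussian `N(m, σ² I_d)` on `ℝ^d`. -/
def isoGaussian {d : ℕ} (m : EuclideanSpace ℝ (Fin d)) (σ : ℝ) :
    Measure (EuclideanSpace ℝ (Fin d)) :=
  multivariateGaussian m (σ ^ 2 • (1 : Matrix (Fin d) (Fin d) ℝ))

/-- Output law of the subsampled Gaussian mechanism on the dataset `D`: every example of `D` is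
kept independently with probability `q`, and `N(f T, σ² I_d)` is released for the sample `T`.
`D.powerset` lists one entry per subset of the `|D|` records (so it has `2 ^ |D|` entries, with
repetitions if `D` has repeated examples), and the subset `T` is drawn with probability
`q ^ |T| * (1 - q) ^ (|D| - |T|)`. -/
def mechanism {X : Type*} {d : ℕ} (f : Multiset X → EuclideanSpace ℝ (Fin d)) (q σ : ℝ)
    (D : Multiset X) : Measure (EuclideanSpace ℝ (Fin d)) :=
  (D.powerset.map fun T =>
    ENNReal.ofReal (q ^ T.card * (1 - q) ^ (D.card - T.card)) • isoGaussian (f T) σ).sum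

/-- Rényi divergence of order `α > 1`,
`D_α(P ‖ Q) = (α - 1)⁻¹ log ∫ (dP/dQ)^α dQ` if `P ≪ Q`, and `+∞` otherwise,
with values in the extended reals. -/
def renyiDiv {Ω : Type*} [MeasurableSpace Ω] (α : ℝ) (P Q : Measure Ω) : EReal :=
  open Classical in
  if P ≪ Q then
    (((α - 1)⁻¹ : ℝ) : EReal) * ENNReal.log (∫⁻ x, (P.rnDeriv Q x) ^ α ∂Q)
  else ⊤

/-- The one-dimensional Gaussian `N(m, s²)`. -/
def gaussian1 (m s : ℝ) : Measure ℝ := gaussianReal m (s ^ 2).toNNReal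

/-- The mixture `(1 - p) N(0, s²) + p N(1, s²)`. -/
def gaussianMix (p s : ℝ) : Measure ℝ :=
  ENNReal.ofReal (1 - p) • gaussian1 0 s + ENNReal.ofReal p • gaussian1 1 s

/-- The Rényi bound `SG(α, p, s)` of the unit-sensitivity subsampled Gaussian mechanism. -/
def SG (α p s : ℝ) : EReal :=
  max (renyiDiv α (gaussian1 0 s) (gaussianMix p s))
    (renyiDiv α (gaussianMix p s) (gaussian1 0 s))

end SGM

end

/-!
The proof compares hockey-stick divergences `E_γ(P ‖ Q) = ∫ (dP - γ dQ)₊`. For `α > 1`,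
`∫ (dP/dQ)^α dQ = α (α - 1) ∫₀^∞ γ^(α - 2) E_γ(P ‖ Q) dγ`, and the substitution `γ ↦ γ⁻¹` on `(0, 1)`
turns this into an integral over `γ > 1` of `γ^(α - 2) E_γ + γ^(-α) E_{γ⁻¹}`. Since
`γ^(α - 2) ≥ γ^(-α)`, a Rényi comparison follows from `E_γ ≤ E⁰_γ` together with
`E_γ + E_{γ⁻¹} ≤ E⁰_γ + E⁰_{γ⁻¹}` for all `γ > 1` (`renyiDiv_le_of_hockeyStick_le`). The individual
inequality at `γ⁻¹` is not needed; this matters when records are both added and removed.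

Write `D = C + A` and `D' = C + B` with `C = D ∩ D'` and `|A| + |B| ≤ r`, and let `u = (1 - q)^|A|`,
`v = (1 - q)^|B|`, `w = (1 - q)^r ≤ u v`. Put `Ω(x, y) = ∫ (x dN(1, s²) - y dN(0, s²))₊` with
`s = σ / r`. Two Gaussians with means at distance at most `r` satisfy
`x N_m(S) - y N_m'(S) ≤ Ω(x, y)` for every event `S`, by the Neyman–Pearson lemma and monotonicity
in the shift (`isoGaussian_sub_le`). Given the sample from `C`, both mechanisms share the Gaussian
obtained when no private record is kept. With `m = min u (γ v)` the mass common to `P` and `γ Q`,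
cancelling it leaves `E_γ ≤ Ω(1 - m, γ - m)` (`sampleMean_sub_le`, `mechanism_sub_le`).

For the mixture `(1 - p) N(0, s²) + p N(1, s²)` with `p = 1 - w` relative to `N(0, s²)`, the
divergence is exactly `E⁰_γ = Ω(1 - w, γ - w)`. Reflection gives `Ω(x, y) = x - y + Ω(y, x)`, so in
terms of `η(x) = Ω(x, x + γ - 1)` the two required inequalities become `η(1 - m) ≤ η(1 - w)` and
`η(1 - m) + γ⁻¹ η(1 - m') ≤ η(1 - w) + γ⁻¹ η(1 - γ w)` with `m' = min (γ u) v`. They hold because `η`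
is monotone and `η(t x) ≤ t η(x)` for `0 ≤ t ≤ 1` (`gaussianHockey_min_le`,
`gaussianHockey_min_add_le`). Thus the second of the two divergences in `SG` already bounds both
directions.
-/

namespace SGM

/-! ### Rényi divergence and hockey-stick divergences -/

/-- Taylor's formula with integral remainder for `l ↦ l ^ α` at `0`, in `ℝ≥0∞` with truncated
subtraction. -/
theorem rpow_eq_lintegral_tsub {α : ℝ} (hα : 1 < α) {l : ℝ≥0∞} (hl : l ≠ ∞) :
    l ^ α = ENNReal.ofReal (α * (α - 1)) *
      ∫⁻ γ in Set.Ioi (0 : ℝ), ENNReal.ofReal (γ ^ (α - 2)) * (l - ENNReal.ofReal γ) := by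
  lift l to ℝ≥0 using hl
  have hL : (l : ℝ≥0∞) = ENNReal.ofReal (l : ℝ) := by simp
  set L : ℝ := NNReal.toReal l
  have hL0 : 0 ≤ L := l.2
  have key : ∫ γ in (0 : ℝ)..L, γ ^ (α - 2) * (L - γ) = L ^ α / (α * (α - 1)) := by
    have h1 : ∫ γ in (0 : ℝ)..L, γ ^ (α - 2) * (L - γ)
        = ∫ γ in (0 : ℝ)..L, (L * γ ^ (α - 2) - γ ^ (α - 1)) := by
      refine intervalIntegral.integral_congr_ae (Filter.Eventually.of_forall fun γ hγ => ?_)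
      rw [Set.uIoc_of_le hL0] at hγ
      have : γ ^ (α - 1) = γ ^ (α - 2) * γ := by
        rw [← Real.rpow_add_one hγ.1.ne']; ring_nf
      rw [this]; ring
    rw [h1, intervalIntegral.integral_sub, intervalIntegral.integral_const_mul,
      integral_rpow (Or.inl (by linarith)), integral_rpow (Or.inl (by linarith))]
    · rw [Real.zero_rpow (by linarith), Real.zero_rpow (by linarith)]
      have e1 : α - 2 + 1 = α - 1 := by ring
      have e2 : α - 1 + 1 = α := by ring
      rw [e1, e2]
      have hm : L * L ^ (α - 1) = L ^ α := by
        rcases hL0.eq_or_lt with h | h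
        · rw [← h, Real.zero_rpow (by linarith : α ≠ 0)]; simp
        · rw [mul_comm, ← Real.rpow_add_one h.ne', e2]
      have : α - 1 ≠ 0 := by linarith
      have : α ≠ 0 := by linarith
      field_simp
      linear_combination (α) * hm
    · exact (intervalIntegral.intervalIntegrable_rpow' (by linarith)).const_mul _
    · exact intervalIntegral.intervalIntegrable_rpow' (by linarith)
  have hint : IntegrableOn (fun γ : ℝ => γ ^ (α - 2) * (L - γ)) (Set.Ioc 0 L) := by
    rw [← intervalIntegrable_iff_integrableOn_Ioc_of_le hL0]
    exact (intervalIntegral.intervalIntegrable_rpow' (by linarith)).mul_continuousOn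
      (by fun_prop)
  have h2 : ∫⁻ γ in Set.Ioi (0 : ℝ), ENNReal.ofReal (γ ^ (α - 2)) * ((l : ℝ≥0∞) - ENNReal.ofReal γ)
      = ∫⁻ γ in Set.Ioc 0 L, ENNReal.ofReal (γ ^ (α - 2) * (L - γ)) := by
    rw [← lintegral_indicator measurableSet_Ioi, ← lintegral_indicator measurableSet_Ioc]
    congr 1
    ext γ
    simp only [Set.indicator, Set.mem_Ioi, Set.mem_Ioc]
    by_cases h0 : 0 < γ
    · rw [if_pos h0, hL, ← ENNReal.ofReal_sub _ h0.le, ← ENNReal.ofReal_mul (by positivity)]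
      split_ifs with h
      · rfl
      · rw [ENNReal.ofReal_of_nonpos]
        have : L < γ := by simpa [h0] using h
        exact mul_nonpos_of_nonneg_of_nonpos (by positivity) (by linarith)
    · simp [h0]
  have hα' : 0 < α * (α - 1) := mul_pos (by linarith) (by linarith)
  rw [h2, ← ofReal_integral_eq_lintegral_ofReal hint, ← intervalIntegral.integral_of_le hL0, key,
    ← ENNReal.ofReal_mul hα'.le, mul_div_cancel₀ _ hα'.ne', hL,
    ENNReal.ofReal_rpow_of_nonneg hL0 (by linarith)]
  refine (ae_restrict_iff' measurableSet_Ioc).2 (Filter.Eventually.of_forall fun γ hγ => ?_)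
  exact mul_nonneg (Real.rpow_nonneg hγ.1.le _) (by linarith [hγ.2])

/-- The half-line folded onto `(1, ∞)` by `γ ↦ γ⁻¹`. -/
theorem lintegral_Ioi_zero_eq_lintegral_Ioi_one {g : ℝ → ℝ≥0∞} :
    ∫⁻ γ in Set.Ioi (0 : ℝ), g γ
      = (∫⁻ γ in Set.Ioi (1 : ℝ), g γ)
        + ∫⁻ γ in Set.Ioi (1 : ℝ), ENNReal.ofReal (γ ^ (-2 : ℝ)) * g γ⁻¹ := by
  have hsplit : Set.Ioi (0 : ℝ) = Set.Ioc 0 1 ∪ Set.Ioi 1 := by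
    rw [Set.Ioc_union_Ioi_eq_Ioi zero_le_one]
  have himg : (fun γ : ℝ => γ⁻¹) '' Set.Ioi 1 = Set.Ioo 0 1 := by
    rw [Set.image_inv_eq_inv, Set.inv_Ioi₀ zero_lt_one, inv_one]
  rw [hsplit, lintegral_union measurableSet_Ioi (by
    rw [Set.disjoint_left]; intro x hx hx'; exact absurd hx.2 (not_le.2 (Set.mem_Ioi.1 hx'))), add_comm]
  congr 1
  rw [setLIntegral_congr Ioo_ae_eq_Ioc.symm, ← himg,
    lintegral_image_eq_lintegral_abs_deriv_mul measurableSet_Ioi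
      (f' := fun γ => -(γ ^ 2)⁻¹) (fun x hx => ?_) (inv_injective.injOn)]
  · refine setLIntegral_congr_fun measurableSet_Ioi fun γ hγ => ?_
    have : (0 : ℝ) < γ := lt_trans zero_lt_one hγ
    simp only [abs_neg, abs_inv, abs_pow, abs_of_pos this]
    rw [Real.rpow_neg this.le]; norm_cast
  · exact (hasDerivAt_inv (lt_trans zero_lt_one hx).ne').hasDerivWithinAt

section HockeyStick

variable {Ω Ω' : Type*} [MeasurableSpace Ω] [MeasurableSpace Ω']

/-- The hockey-stick divergence `E_γ(P ‖ Q) = ∫ (dP/dQ - γ)₊ dQ`, the truncated subtraction of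
`ℝ≥0∞` providing the positive part. -/
noncomputable def hockeyStick (P Q : Measure Ω) (γ : ℝ) : ℝ≥0∞ :=
  ∫⁻ x, (P.rnDeriv Q x - ENNReal.ofReal γ) ∂Q

theorem measurable_hockeyStick (P Q : Measure Ω) [SFinite Q] : Measurable (hockeyStick P Q) := by
  unfold hockeyStick
  refine Measurable.lintegral_prod_right' (f := fun p : ℝ × Ω =>
    P.rnDeriv Q p.2 - ENNReal.ofReal p.1) ?_
  exact ((Measure.measurable_rnDeriv P Q).comp measurable_snd).sub
    (ENNReal.measurable_ofReal.comp measurable_fst)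

/-- The Rényi moment is a weighted integral of hockey-stick divergences. -/
theorem lintegral_rnDeriv_rpow_eq (P Q : Measure Ω) [IsFiniteMeasure P] [IsFiniteMeasure Q]
    {α : ℝ} (hα : 1 < α) :
    ∫⁻ x, (P.rnDeriv Q x) ^ α ∂Q = ENNReal.ofReal (α * (α - 1)) *
      ∫⁻ γ in Set.Ioi (0 : ℝ), ENNReal.ofReal (γ ^ (α - 2)) * hockeyStick P Q γ := by
  have hm : Measurable fun p : Ω × ℝ =>
      ENNReal.ofReal (p.2 ^ (α - 2)) * (P.rnDeriv Q p.1 - ENNReal.ofReal p.2) := by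
    have := Measure.measurable_rnDeriv P Q
    fun_prop
  calc ∫⁻ x, (P.rnDeriv Q x) ^ α ∂Q
      = ∫⁻ x, ENNReal.ofReal (α * (α - 1)) * (∫⁻ γ in Set.Ioi (0 : ℝ),
          ENNReal.ofReal (γ ^ (α - 2)) * (P.rnDeriv Q x - ENNReal.ofReal γ)) ∂Q := by
        refine lintegral_congr_ae ?_
        filter_upwards [Measure.rnDeriv_ne_top P Q] with x hx
        exact rpow_eq_lintegral_tsub hα hx
    _ = ENNReal.ofReal (α * (α - 1)) * ∫⁻ x, (∫⁻ γ in Set.Ioi (0 : ℝ),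
          ENNReal.ofReal (γ ^ (α - 2)) * (P.rnDeriv Q x - ENNReal.ofReal γ)) ∂Q := by
        rw [lintegral_const_mul _ hm.lintegral_prod_right']
    _ = _ := by
        rw [lintegral_lintegral_swap hm.aemeasurable]
        congr 1
        refine lintegral_congr fun γ => ?_
        rw [lintegral_const_mul' _ _ ENNReal.ofReal_ne_top, hockeyStick]

/-- After folding, the weight `γ ^ (α - 2)` of `E_γ` is at least the weight `γ ^ (-α)` of
`E_{γ⁻¹}` for `γ > 1`; this is why a bound for `E_γ` and one for the plain sum
`E_γ + E_{γ⁻¹}` suffice, without any bound for `E_{γ⁻¹}` itself. -/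
theorem lintegral_rnDeriv_rpow_le {P Q : Measure Ω} {P₀ Q₀ : Measure Ω'}
    [IsFiniteMeasure P] [IsFiniteMeasure Q] [IsFiniteMeasure P₀] [IsFiniteMeasure Q₀]
    {α : ℝ} (hα : 1 < α)
    (h₁ : ∀ γ : ℝ, 1 < γ → hockeyStick P Q γ ≤ hockeyStick P₀ Q₀ γ)
    (h₂ : ∀ γ : ℝ, 1 < γ → hockeyStick P Q γ + hockeyStick P Q γ⁻¹
      ≤ hockeyStick P₀ Q₀ γ + hockeyStick P₀ Q₀ γ⁻¹) :
    ∫⁻ x, (P.rnDeriv Q x) ^ α ∂Q ≤ ∫⁻ x, (P₀.rnDeriv Q₀ x) ^ α ∂Q₀ := by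
  have hme := measurable_hockeyStick P Q
  have hme₀ := measurable_hockeyStick P₀ Q₀
  rw [lintegral_rnDeriv_rpow_eq P Q hα, lintegral_rnDeriv_rpow_eq P₀ Q₀ hα,
    lintegral_Ioi_zero_eq_lintegral_Ioi_one, lintegral_Ioi_zero_eq_lintegral_Ioi_one,
    ← lintegral_add_left (by fun_prop), ← lintegral_add_left (by fun_prop)]
  gcongr ENNReal.ofReal _ * ?_
  refine setLIntegral_mono' measurableSet_Ioi fun γ (hγ : 1 < γ) => ?_
  have hγ0 : 0 < γ := zero_lt_one.trans hγ
  have hw : ENNReal.ofReal (γ ^ (-2 : ℝ)) * ENNReal.ofReal (γ⁻¹ ^ (α - 2))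
      = ENNReal.ofReal (γ ^ (-α)) := by
    rw [← ENNReal.ofReal_mul (by positivity), Real.inv_rpow hγ0.le, ← Real.rpow_neg hγ0.le,
      ← Real.rpow_add hγ0]
    ring_nf
  obtain ⟨c, hc⟩ : ∃ c, ENNReal.ofReal (γ ^ (α - 2)) = ENNReal.ofReal (γ ^ (-α)) + c :=
    exists_add_of_le (ENNReal.ofReal_le_ofReal
      (Real.rpow_le_rpow_of_exponent_le hγ.le (by linarith)))
  simp only [← mul_assoc, hw, hc]
  calc _ = ENNReal.ofReal (γ ^ (-α)) * (hockeyStick P Q γ + hockeyStick P Q γ⁻¹)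
        + c * hockeyStick P Q γ := by ring
    _ ≤ ENNReal.ofReal (γ ^ (-α)) * (hockeyStick P₀ Q₀ γ + hockeyStick P₀ Q₀ γ⁻¹)
        + c * hockeyStick P₀ Q₀ γ := by
        exact add_le_add (mul_le_mul' le_rfl (h₂ γ hγ)) (mul_le_mul' le_rfl (h₁ γ hγ))
    _ = _ := by ring

theorem renyiDiv_le_of_hockeyStick_le {P Q : Measure Ω} {P₀ Q₀ : Measure Ω'}
    [IsFiniteMeasure P] [IsFiniteMeasure Q] [IsFiniteMeasure P₀] [IsFiniteMeasure Q₀]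
    {α : ℝ} (hα : 1 < α) (hPQ : P ≪ Q)
    (h₁ : ∀ γ : ℝ, 1 < γ → hockeyStick P Q γ ≤ hockeyStick P₀ Q₀ γ)
    (h₂ : ∀ γ : ℝ, 1 < γ → hockeyStick P Q γ + hockeyStick P Q γ⁻¹
      ≤ hockeyStick P₀ Q₀ γ + hockeyStick P₀ Q₀ γ⁻¹) :
    renyiDiv α P Q ≤ renyiDiv α P₀ Q₀ := by
  unfold renyiDiv
  rw [if_pos hPQ]
  split_ifs
  · refine mul_le_mul_of_nonneg_left (ENNReal.log_monotone (lintegral_rnDeriv_rpow_le hα h₁ h₂)) ?_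
    exact EReal.coe_nonneg.2 (inv_nonneg.2 (by linarith))
  · exact le_top

/-- The hockey-stick divergence is the value of `P - γ Q` on `{dP/dQ > γ}`. -/
theorem hockeyStick_le_ofReal {P Q : Measure Ω} [IsFiniteMeasure P] [IsFiniteMeasure Q]
    (hPQ : P ≪ Q) {γ b : ℝ} (hγ : 0 ≤ γ)
    (h : ∀ s, MeasurableSet s → P.real s - γ * Q.real s ≤ b) :
    hockeyStick P Q γ ≤ ENNReal.ofReal b := by
  set s : Set Ω := {x | ENNReal.ofReal γ < P.rnDeriv Q x} with hs
  have hsm : MeasurableSet s := measurableSet_lt measurable_const (Measure.measurable_rnDeriv P Q)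
  have h1 : hockeyStick P Q γ = ∫⁻ x in s, (P.rnDeriv Q x - ENNReal.ofReal γ) ∂Q := by
    rw [hockeyStick, ← lintegral_indicator hsm]
    congr 1
    ext x
    by_cases hx : x ∈ s
    · simp [hx]
    · rw [Set.indicator_of_notMem hx]
      exact tsub_eq_zero_of_le (not_lt.1 hx)
  have h2 : hockeyStick P Q γ = P s - ENNReal.ofReal γ * Q s := by
    rw [h1, lintegral_sub (by fun_prop) (by
      simpa using ENNReal.mul_ne_top ENNReal.ofReal_ne_top (measure_ne_top Q s)) (by
      refine (ae_restrict_iff' hsm).2 (Filter.Eventually.of_forall fun x hx => le_of_lt hx)),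
      Measure.setLIntegral_rnDeriv hPQ, setLIntegral_const]
  rw [h2, ← ofReal_measureReal (μ := P), ← ofReal_measureReal (μ := Q), ← ENNReal.ofReal_mul hγ,
    ← ENNReal.ofReal_sub _ (by positivity)]
  exact ENNReal.ofReal_le_ofReal (h s hsm)

end HockeyStick

/-! ### The one-dimensional pair of Gaussians -/

theorem gaussianReal_eq_withDensity (m m' : ℝ) {v : ℝ≥0} (hv : v ≠ 0) :
    gaussianReal m v = (gaussianReal m' v).withDensity fun z =>
      ENNReal.ofReal (Real.exp ((m - m') * (z - m') / v - (m - m') ^ 2 / (2 * v))) := by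
  rw [gaussianReal_of_var_ne_zero _ hv, gaussianReal_of_var_ne_zero _ hv,
    ← withDensity_mul _ (by fun_prop) (by fun_prop)]
  congr 1
  ext z
  have hv' : (v : ℝ) ≠ 0 := by exact_mod_cast hv
  simp only [Pi.mul_apply, gaussianPDF, gaussianPDFReal]
  rw [← ENNReal.ofReal_mul (by positivity), mul_assoc _ (Real.exp _) (Real.exp _), ← Real.exp_add]
  congr 3
  field_simp
  ring

/-- The likelihood ratio of `N(1, s²)` with respect to `N(0, s²)`. -/
noncomputable def likelihoodRatio (s z : ℝ) : ℝ := Real.exp (z / s ^ 2 - 1 / (2 * s ^ 2))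

/-- The positive part `∫ (x dN(1, s²) - y dN(0, s²))₊`, with both densities taken relative to
`N(0, s²)`. The coefficients `x` and `y` may be negative. -/
noncomputable def gaussianHockey (s x y : ℝ) : ℝ :=
  ∫ z, max (x * likelihoodRatio s z - y) 0 ∂gaussian1 0 s

section

variable {s : ℝ}

instance (m s : ℝ) : IsProbabilityMeasure (gaussian1 m s) := by
  unfold gaussian1; infer_instance

theorem likelihoodRatio_pos (s z : ℝ) : 0 < likelihoodRatio s z := Real.exp_pos _

@[fun_prop]
theorem measurable_likelihoodRatio (s : ℝ) : Measurable (likelihoodRatio s) := by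
  unfold likelihoodRatio; fun_prop

theorem gaussian1_one_eq (hs : 0 < s) : gaussian1 1 s =
    (gaussian1 0 s).withDensity fun z => ENNReal.ofReal (likelihoodRatio s z) := by
  have h2 : (0 : ℝ) < s ^ 2 := by positivity
  rw [gaussian1, gaussianReal_eq_withDensity 1 0 (by simpa using h2.ne')]
  simp [gaussian1, likelihoodRatio, Real.coe_toNNReal _ h2.le]

theorem integrable_likelihoodRatio (s : ℝ) :
    Integrable (likelihoodRatio s) (gaussian1 0 s) := by
  refine ((integrable_exp_mul_gaussianReal (μ := 0) (v := (s ^ 2).toNNReal)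
    (1 / s ^ 2)).const_mul (Real.exp (-(1 / (2 * s ^ 2))))).congr ?_
  refine Filter.Eventually.of_forall fun z => ?_
  simp only [likelihoodRatio]
  rw [← Real.exp_add]
  ring_nf

theorem integral_gaussian1_one (hs : 0 < s) (g : ℝ → ℝ) :
    ∫ z, g z ∂gaussian1 1 s = ∫ z, likelihoodRatio s z * g z ∂gaussian1 0 s := by
  rw [gaussian1_one_eq hs, integral_withDensity_eq_integral_toReal_smul
    (by fun_prop) (Filter.Eventually.of_forall fun _ => ENNReal.ofReal_lt_top)]
  simp [ENNReal.toReal_ofReal (likelihoodRatio_pos _ _).le]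

theorem integral_likelihoodRatio (hs : 0 < s) :
    ∫ z, likelihoodRatio s z ∂gaussian1 0 s = 1 := by
  simpa using (integral_gaussian1_one hs fun _ => 1).symm

theorem integrable_hockey (s : ℝ) (x y : ℝ) :
    Integrable (fun z => max (x * likelihoodRatio s z - y) 0) (gaussian1 0 s) :=
  (((integrable_likelihoodRatio s).const_mul x).sub (integrable_const y)).pos_part

theorem sub_le_gaussianHockey (hs : 0 < s) (x y : ℝ) {A : Set ℝ} (hA : MeasurableSet A) :
    x * (gaussian1 1 s).real A - y * (gaussian1 0 s).real A ≤ gaussianHockey s x y := by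
  have h1 : (gaussian1 1 s).real A = ∫ z in A, likelihoodRatio s z ∂gaussian1 0 s := by
    rw [← integral_indicator_one hA, integral_gaussian1_one hs, ← integral_indicator hA]
    congr 1
    ext z
    by_cases hz : z ∈ A <;> simp [hz]
  have hi := (integrable_likelihoodRatio s).integrableOn (s := A)
  calc x * (gaussian1 1 s).real A - y * (gaussian1 0 s).real A
      = ∫ z in A, (x * likelihoodRatio s z - y) ∂gaussian1 0 s := by
        rw [integral_sub (hi.const_mul x) (integrable_const y), integral_const_mul, ← h1]
        simp [mul_comm]
    _ ≤ ∫ z in A, max (x * likelihoodRatio s z - y) 0 ∂gaussian1 0 s :=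
        integral_mono ((hi.const_mul x).sub (integrable_const y))
          (integrable_hockey s x y).integrableOn fun _ => le_max_left _ _
    _ ≤ _ := setIntegral_le_integral (integrable_hockey s x y)
        (Filter.Eventually.of_forall fun _ => le_max_right _ _)

theorem gaussianHockey_nonneg (s x y : ℝ) : 0 ≤ gaussianHockey s x y :=
  integral_nonneg fun _ => le_max_right _ _

theorem gaussianHockey_eq_zero (s : ℝ) {x y : ℝ} (hx : x ≤ 0) (hy : 0 ≤ y) :
    gaussianHockey s x y = 0 := by
  refine integral_eq_zero_of_ae (Filter.Eventually.of_forall fun z => ?_)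
  have := mul_nonpos_of_nonpos_of_nonneg hx (likelihoodRatio_pos s z).le
  exact max_eq_right (by linarith)

theorem gaussianHockey_mul (s : ℝ) {c : ℝ} (hc : 0 ≤ c) (x y : ℝ) :
    gaussianHockey s (c * x) (c * y) = c * gaussianHockey s x y := by
  unfold gaussianHockey
  rw [← integral_const_mul]
  congr 1
  ext z
  rw [mul_max_of_nonneg _ _ hc, mul_zero, mul_sub, mul_assoc]

theorem gaussianHockey_anti (s : ℝ) (x : ℝ) {y y' : ℝ} (h : y ≤ y') :
    gaussianHockey s x y' ≤ gaussianHockey s x y :=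
  integral_mono (integrable_hockey s x y') (integrable_hockey s x y) fun z =>
    max_le_max (by simp only; linarith) le_rfl

/-- Exchanging the two Gaussians by the reflection `z ↦ 1 - z`. -/
theorem gaussianHockey_swap (hs : 0 < s) (x y : ℝ) :
    gaussianHockey s x y = x - y + gaussianHockey s y x := by
  have hmap : gaussian1 0 s = (gaussian1 1 s).map fun z => 1 - z := by
    rw [gaussian1, gaussian1, gaussianReal_map_const_sub, sub_self]
  have hinv : ∀ z, likelihoodRatio s z * likelihoodRatio s (1 - z) = 1 := fun z => by
    rw [likelihoodRatio, likelihoodRatio, ← Real.exp_add]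
    rw [show z / s ^ 2 - 1 / (2 * s ^ 2) + ((1 - z) / s ^ 2 - 1 / (2 * s ^ 2)) = 0 by
      field_simp; ring, Real.exp_zero]
  have h1 : ∫ z, max (y - x * likelihoodRatio s z) 0 ∂gaussian1 0 s = gaussianHockey s y x := by
    conv_lhs => rw [hmap]
    rw [integral_map (by fun_prop) (by fun_prop), integral_gaussian1_one hs, gaussianHockey]
    congr 1
    ext z
    rw [mul_max_of_nonneg _ _ (likelihoodRatio_pos s z).le, mul_zero]
    congr 1
    linear_combination (-x) * hinv z
  have h2 : gaussianHockey s x y - ∫ z, max (y - x * likelihoodRatio s z) 0 ∂gaussian1 0 s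
      = x - y := by
    have hi := integrable_likelihoodRatio s
    have hi' : Integrable (fun z => max (y - x * likelihoodRatio s z) 0) (gaussian1 0 s) :=
      ((integrable_const y).sub (hi.const_mul x)).pos_part
    rw [gaussianHockey, ← integral_sub (integrable_hockey s x y) hi']
    calc _ = ∫ z, (x * likelihoodRatio s z - y) ∂gaussian1 0 s := by
          congr 1
          ext z
          rcases le_total (x * likelihoodRatio s z) y with h | h
          · rw [max_eq_right (by linarith), max_eq_left (by linarith)]; ring
          · rw [max_eq_left (by linarith), max_eq_right (by linarith)]; ring
      _ = x - y := by
          rw [integral_sub (hi.const_mul x) (integrable_const y), integral_const_mul,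
            integral_likelihoodRatio hs]
          simp
  linarith

/-- Along the lines of slope one the hockey-stick functional is star-shaped at `0`. -/
theorem gaussianHockey_line_mul_le (s : ℝ) {k t x : ℝ} (hk : 0 ≤ k) (ht : 0 ≤ t)
    (ht1 : t ≤ 1) : gaussianHockey s (t * x) (t * x + k) ≤ t * gaussianHockey s x (x + k) := by
  rw [← gaussianHockey_mul s ht]
  exact gaussianHockey_anti s _ (by nlinarith)

theorem gaussianHockey_line_mono (s : ℝ) {k x x' : ℝ} (hk : 0 ≤ k)
    (h : x ≤ x') (hx : 0 ≤ x + k) :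
    gaussianHockey s x (x + k) ≤ gaussianHockey s x' (x' + k) := by
  rcases le_or_gt x 0 with h0 | h0
  · rw [gaussianHockey_eq_zero s h0 hx]
    exact gaussianHockey_nonneg _ _ _
  · have hx0 : 0 < x' := h0.trans_le h
    have := gaussianHockey_line_mul_le s (x := x') hk (t := x / x') (by positivity)
      ((div_le_one hx0).2 h)
    rw [div_mul_cancel₀ _ hx0.ne'] at this
    exact this.trans (mul_le_of_le_one_left (gaussianHockey_nonneg _ _ _) ((div_le_one hx0).2 h))

/-- By homogeneity the line with offset `1 - γ⁻¹` is a rescaling of the one with offset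
`γ - 1`. -/
theorem gaussianHockey_line_inv (s : ℝ) {γ : ℝ} (hγ : 0 < γ) (x : ℝ) :
    gaussianHockey s x (x + (1 - γ⁻¹)) = γ⁻¹ * gaussianHockey s (γ * x) (γ * x + (γ - 1)) := by
  rw [← gaussianHockey_mul s (by positivity)]
  congr 1 <;> field_simp

/-- Here `u` and `v` stand for the probabilities of keeping none of the records private to the
first and to the second dataset, and `min u (γ * v)` is the mass that cancels in `P - γ Q`. For
`γ > 1` the one-sided mixture with parameter `1 - w` dominates. -/
theorem gaussianHockey_min_le (s : ℝ) {u v w γ : ℝ} (hu0 : 0 ≤ u) (hu1 : u ≤ 1)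
    (hw : w ≤ u * v) (hv1 : v ≤ 1) (hγ : 1 < γ) (hv0 : 0 ≤ v) :
    gaussianHockey s (1 - min u (γ * v)) (γ - min u (γ * v))
      ≤ gaussianHockey s (1 - w) (γ - w) := by
  have e : ∀ m : ℝ, γ - m = (1 - m) + (γ - 1) := fun m => by ring
  have hwm : w ≤ min u (γ * v) := le_min (by nlinarith) (by nlinarith)
  have := min_le_left u (γ * v)
  rw [e, e w]
  exact gaussianHockey_line_mono s (by linarith) (by linarith) (by linarith)

/-- The bound for `E_γ + E_{γ⁻¹}`. The terms at `γ⁻¹` alone need not be ordered; reflection turns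
them into values of the same star-shaped function as the terms at `γ`, and monotonicity and
star-shapedness then settle the sum. -/
theorem gaussianHockey_min_add_le (hs : 0 < s) {u v w γ : ℝ} (hu0 : 0 ≤ u) (hu1 : u ≤ 1)
    (hv0 : 0 ≤ v) (hv1 : v ≤ 1) (hw : w ≤ u * v) (hγ : 1 < γ) :
    gaussianHockey s (1 - min u (γ * v)) (γ - min u (γ * v))
        + gaussianHockey s (1 - min u (γ⁻¹ * v)) (γ⁻¹ - min u (γ⁻¹ * v))
      ≤ gaussianHockey s (1 - w) (γ - w) + gaussianHockey s (1 - w) (γ⁻¹ - w) := by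
  have hγ0 : 0 < γ := zero_lt_one.trans hγ
  have hi1 : γ⁻¹ < 1 := inv_lt_one_of_one_lt₀ hγ
  have hi0 : 0 < γ⁻¹ := inv_pos.2 hγ0
  -- all four terms are values of `η`, those at `γ⁻¹` by reflection and rescaling
  set η : ℝ → ℝ := fun x => gaussianHockey s x (x + (γ - 1)) with hη
  have e1 : ∀ m : ℝ, gaussianHockey s (1 - m) (γ - m) = η (1 - m) := fun m => by
    simp only [hη]; ring_nf
  have e2 : ∀ m : ℝ, gaussianHockey s (1 - m) (γ⁻¹ - m) = 1 - γ⁻¹ + γ⁻¹ * η (1 - γ * m) := by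
    intro m
    rw [gaussianHockey_swap hs, show (1 : ℝ) - m = (γ⁻¹ - m) + (1 - γ⁻¹) by ring,
      gaussianHockey_line_inv s hγ0, show γ * (γ⁻¹ - m) = 1 - γ * m by field_simp]
    ring
  have hmono : ∀ {x x' : ℝ}, 0 ≤ x + (γ - 1) → x ≤ x' → η x ≤ η x' := fun hx h =>
    gaussianHockey_line_mono s (by linarith) h hx
  have hstar : ∀ {t x : ℝ}, 0 ≤ t → t ≤ 1 → η (t * x) ≤ t * η x := fun ht ht1 =>
    gaussianHockey_line_mul_le s (by linarith) ht ht1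
  have hmul : γ * min u (γ⁻¹ * v) = min (γ * u) v := by
    rw [mul_min_of_nonneg _ _ hγ0.le, mul_inv_cancel_left₀ hγ0.ne']
  rw [e1, e1, e2, e2, hmul]
  suffices η (1 - min u (γ * v)) + γ⁻¹ * η (1 - min (γ * u) v)
      ≤ η (1 - w) + γ⁻¹ * η (1 - γ * w) by linarith
  have hwu : w ≤ u := by nlinarith
  have hwv : w ≤ v := by nlinarith
  have hγw : γ * w ≤ γ * u := by gcongr
  rcases le_total (γ * u) v with h | h
  · -- `γ u ≤ v`: termwise
    rw [min_eq_left h, min_eq_left (by nlinarith)]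
    exact add_le_add (hmono (by linarith) (by linarith))
      (mul_le_mul_of_nonneg_left (hmono (by linarith) (by linarith)) hi0.le)
  rw [min_eq_right h]
  rcases le_total (γ * v) u with h' | h'
  · -- `γ v ≤ u`: exchange the weights of the two terms
    rw [min_eq_right h']
    have hvv : v ≤ γ * v := by nlinarith
    have a1 : η (1 - γ * v) ≤ η (1 - v) := hmono (by linarith) (by linarith)
    have a2 : η (1 - v) ≤ η (1 - w) := hmono (by linarith) (by linarith)
    have a3 : η (1 - γ * v) ≤ η (1 - γ * w) := hmono (by linarith) (by nlinarith)
    nlinarith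
  rw [min_eq_left h']
  rcases le_total (γ * u) 1 with h1 | h1
  · -- `γ u ≤ 1`: termwise, since `γ w ≤ γ u v ≤ v`
    have : γ * w ≤ v := by nlinarith
    exact add_le_add (hmono (by linarith) (by linarith))
      (mul_le_mul_of_nonneg_left (hmono (by linarith) (by linarith)) hi0.le)
  · -- `γ u ≥ 1`: the first term of the right-hand side suffices
    have hnn : 0 ≤ γ⁻¹ * η (1 - γ * w) := mul_nonneg hi0.le (gaussianHockey_nonneg _ _ _)
    have hηw : 0 ≤ η (1 - w) := gaussianHockey_nonneg _ _ _
    have hiu : γ⁻¹ ≤ u := by rwa [inv_le_iff_one_le_mul₀' hγ0]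
    rcases (by linarith : w ≤ 1).eq_or_lt with hw1 | hw1
    · have hu : u = 1 := by linarith
      have hv : v = 1 := by linarith
      have h0 : η 0 ≤ 0 := by simpa using hstar (t := 0) (x := 1) le_rfl zero_le_one
      rw [hu, hv, sub_self]
      nlinarith
    · have hd : 0 < 1 - w := by linarith
      have b : ∀ {a : ℝ}, w ≤ a → a ≤ 1 → η (1 - a) ≤ (1 - a) / (1 - w) * η (1 - w) := by
        intro a ha ha1
        have := hstar (t := (1 - a) / (1 - w)) (x := 1 - w) (div_nonneg (by linarith) hd.le)
          ((div_le_one hd).2 (by linarith))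
        rwa [div_mul_cancel₀ _ hd.ne'] at this
      have c1 : (1 - u) / (1 - w) + γ⁻¹ * ((1 - v) / (1 - w)) ≤ 1 := by
        rw [← mul_div_assoc, ← add_div, div_le_one hd]
        nlinarith
      calc _ ≤ (1 - u) / (1 - w) * η (1 - w) + γ⁻¹ * ((1 - v) / (1 - w) * η (1 - w)) :=
            add_le_add (b hwu hu1) (mul_le_mul_of_nonneg_left (b hwv hv1) hi0.le)
        _ = ((1 - u) / (1 - w) + γ⁻¹ * ((1 - v) / (1 - w))) * η (1 - w) := by ring
        _ ≤ 1 * η (1 - w) := mul_le_mul_of_nonneg_right c1 hηw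
        _ ≤ _ := by linarith

end

/-! ### Isotropic Gaussians -/

theorem lintegral_pi_prod {ι : Type*} [Fintype ι] (μ : ι → Measure ℝ)
    [∀ i, IsProbabilityMeasure (μ i)] {f : ι → ℝ → ℝ≥0∞} (hf : ∀ i, Measurable (f i)) :
    ∫⁻ x, ∏ i, f i (x i) ∂Measure.pi μ = ∏ i, ∫⁻ z, f i z ∂μ i := by
  refine (lintegral_prod_eq_prod_lintegral_of_indepFun (μ := Measure.pi μ) Finset.univ
    (fun i x => f i (x i)) (iIndepFun_pi fun i => (hf i).aemeasurable)
    fun i => (hf i).comp (measurable_pi_apply i)).trans ?_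
  refine Finset.prod_congr rfl fun i _ => ?_
  rw [← (measurePreserving_eval μ i).lintegral_comp (hf i)]

/-- A product of measures with densities has the product density. -/
theorem pi_withDensity {ι : Type*} [Fintype ι] (μ ν : ι → Measure ℝ)
    [∀ i, IsProbabilityMeasure (μ i)] [∀ i, IsProbabilityMeasure (ν i)] {f : ι → ℝ → ℝ≥0∞}
    (hf : ∀ i, Measurable (f i)) (hν : ∀ i, ν i = (μ i).withDensity (f i)) :
    Measure.pi ν = (Measure.pi μ).withDensity fun x => ∏ i, f i (x i) := by
  refine Measure.pi_eq fun s hs => ?_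
  have hind : ∀ x : ι → ℝ, (Set.univ.pi s).indicator (fun x => ∏ i, f i (x i)) x
      = ∏ i, (s i).indicator (f i) (x i) := fun x => by
    by_cases hx : x ∈ Set.univ.pi s
    · rw [Set.indicator_of_mem hx]
      exact Finset.prod_congr rfl fun i _ => (Set.indicator_of_mem (hx i trivial) _).symm
    · rw [Set.indicator_of_notMem hx]
      obtain ⟨i, hi⟩ : ∃ i, x i ∉ s i := by simpa [Set.mem_pi] using hx
      exact (Finset.prod_eq_zero (Finset.mem_univ i) (Set.indicator_of_notMem hi _)).symm
  have hms : MeasurableSet (Set.univ.pi s) := MeasurableSet.univ_pi hs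
  rw [withDensity_apply _ hms, ← lintegral_indicator hms]
  simp_rw [hind]
  rw [lintegral_pi_prod μ fun i => (hf i).indicator (hs i)]
  refine Finset.prod_congr rfl fun i _ => ?_
  rw [lintegral_indicator (hs i), hν i, withDensity_apply _ (hs i)]

section

variable {d : ℕ} {σ : ℝ}

instance (m : EuclideanSpace ℝ (Fin d)) (σ : ℝ) : IsProbabilityMeasure (isoGaussian m σ) := by
  unfold isoGaussian; infer_instance

theorem charFun_isoGaussian (m t : EuclideanSpace ℝ (Fin d)) (σ : ℝ) :
    charFun (isoGaussian m σ) t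
      = Complex.exp ((inner ℝ t m : ℝ) * Complex.I - (σ ^ 2 * ‖t‖ ^ 2 : ℝ) / 2) := by
  have hS : (σ ^ 2 • (1 : Matrix (Fin d) (Fin d) ℝ)).PosSemidef :=
    Matrix.PosSemidef.one.smul (sq_nonneg σ)
  have h : ‖t‖ ^ 2 = t.ofLp ⬝ᵥ t.ofLp := by
    rw [EuclideanSpace.real_norm_sq_eq, dotProduct]
    simp only [sq]
  rw [isoGaussian, charFun_multivariateGaussian hS, h]
  simp [Matrix.smul_mulVec]

/-- The isotropic Gaussian has independent Gaussian coordinates. -/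
theorem isoGaussian_eq_map_pi (m : EuclideanSpace ℝ (Fin d)) (σ : ℝ) :
    isoGaussian m σ = (Measure.pi fun i => gaussianReal (m i) (σ ^ 2).toNNReal).map
      (MeasurableEquiv.toLp 2 (Fin d → ℝ)) := by
  refine Measure.ext_of_charFun (E := EuclideanSpace ℝ (Fin d)) ?_
  ext t
  have := charFun_pi (μ := fun i => gaussianReal (m i) (σ ^ 2).toNNReal) t
  rw [MeasurableEquiv.coe_toLp, this, charFun_isoGaussian]
  simp_rw [charFun_gaussianReal, ← Complex.exp_sum]
  rw [EuclideanSpace.real_norm_sq_eq, PiLp.inner_apply]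
  congr 1
  simp [Finset.mul_sum, Finset.sum_div, Finset.sum_sub_distrib, mul_comm,
    Real.coe_toNNReal _ (sq_nonneg σ)]

/-- The likelihood ratio of `N(m, σ² I)` with respect to `N(m', σ² I)`. -/
noncomputable def isoRatio (m m' : EuclideanSpace ℝ (Fin d)) (σ : ℝ)
    (z : EuclideanSpace ℝ (Fin d)) : ℝ :=
  Real.exp ((inner ℝ (m - m') z - inner ℝ (m - m') m' - ‖m - m'‖ ^ 2 / 2) / σ ^ 2)

@[fun_prop]
theorem measurable_isoRatio (m m' : EuclideanSpace ℝ (Fin d)) (σ : ℝ) :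
    Measurable (isoRatio m m' σ) := by
  unfold isoRatio; fun_prop

theorem isoGaussian_eq_withDensity (m m' : EuclideanSpace ℝ (Fin d)) (hσ : 0 < σ) :
    isoGaussian m σ = (isoGaussian m' σ).withDensity fun z =>
      ENNReal.ofReal (isoRatio m m' σ z) := by
  have h2 : (0 : ℝ) < σ ^ 2 := by positivity
  have hv : (σ ^ 2).toNNReal ≠ 0 := by simpa using h2.ne'
  ext s hs
  have he := (MeasurableEquiv.toLp 2 (Fin d → ℝ)).measurable
  rw [withDensity_apply _ hs, isoGaussian_eq_map_pi, isoGaussian_eq_map_pi,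
    setLIntegral_map hs (by fun_prop) he, Measure.map_apply he hs,
    pi_withDensity (fun i => gaussianReal (m' i) _) _ (fun i => by fun_prop)
      (fun i => gaussianReal_eq_withDensity (m i) (m' i) hv), withDensity_apply _ (he hs)]
  refine lintegral_congr fun x => ?_
  rw [← ENNReal.ofReal_prod_of_nonneg fun i _ => (Real.exp_pos _).le, ← Real.exp_sum, isoRatio]
  congr 2
  rw [EuclideanSpace.real_norm_sq_eq, PiLp.inner_apply, PiLp.inner_apply, Finset.sum_div,
    ← Finset.sum_sub_distrib, ← Finset.sum_sub_distrib, Finset.sum_div]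
  refine Finset.sum_congr rfl fun i _ => ?_
  simp [Real.coe_toNNReal _ h2.le]
  field_simp

theorem isoGaussian_absolutelyContinuous (m m' : EuclideanSpace ℝ (Fin d)) (hσ : 0 < σ) :
    isoGaussian m σ ≪ isoGaussian m' σ := by
  rw [isoGaussian_eq_withDensity m m' hσ]
  exact withDensity_absolutelyContinuous _ _

theorem isoGaussian_map_inner (m e : EuclideanSpace ℝ (Fin d)) (σ : ℝ) :
    (isoGaussian m σ).map (fun z => inner ℝ e z)
      = gaussianReal (inner ℝ e m) (σ ^ 2 * ‖e‖ ^ 2).toNNReal := by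
  have : IsProbabilityMeasure ((isoGaussian m σ).map (fun z => inner ℝ e z)) :=
    Measure.isProbabilityMeasure_map (by fun_prop)
  refine Measure.ext_of_charFun ?_
  ext t
  have h := charFun_isoGaussian m (t • e) σ
  rw [charFun_apply] at h
  rw [charFun_apply_real, integral_map (by fun_prop) (by fun_prop), charFun_gaussianReal,
    Real.coe_toNNReal _ (by positivity)]
  have h' : ∀ z : EuclideanSpace ℝ (Fin d), Complex.exp (t * (inner ℝ e z : ℝ) * Complex.I)
      = Complex.exp ((inner ℝ z (t • e) : ℝ) * Complex.I) := fun z => by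
    rw [real_inner_smul_right, real_inner_comm]; push_cast; rfl
  simp_rw [h', h]
  rw [norm_smul, real_inner_smul_left]
  congr 1
  push_cast
  have : ((‖t‖ : ℝ) : ℂ) ^ 2 = (t : ℂ) ^ 2 := by
    rw [← Complex.ofReal_pow, Real.norm_eq_abs, sq_abs, Complex.ofReal_pow]
  rw [mul_pow, this]
  ring

/-- Neyman–Pearson: the superlevel set of the likelihood ratio maximizes `x μ(A) - y ν(A)`. -/
theorem sub_le_of_withDensity {Ω : Type*} [MeasurableSpace Ω] {μ ν : Measure Ω}
    [IsProbabilityMeasure μ] [IsProbabilityMeasure ν] {g : Ω → ℝ} (hg : Measurable g)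
    (hg0 : ∀ z, 0 ≤ g z)
    (hμ : μ = ν.withDensity fun z => ENNReal.ofReal (g z)) (x y : ℝ) {A : Set Ω}
    (hA : MeasurableSet A) :
    x * μ.real A - y * ν.real A ≤ x * μ.real {z | y < x * g z} - y * ν.real {z | y < x * g z} := by
  have hint : Integrable g ν := by
    refine ⟨hg.aestronglyMeasurable, ?_⟩
    have h1 : ∫⁻ z, ENNReal.ofReal (g z) ∂ν = 1 := by
      rw [← setLIntegral_univ, ← withDensity_apply _ MeasurableSet.univ, ← hμ, measure_univ]
    rw [hasFiniteIntegral_iff_ofReal (Filter.Eventually.of_forall hg0), h1]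
    exact ENNReal.one_lt_top
  have hint' : Integrable (fun z => x * g z - y) ν := (hint.const_mul x).sub (integrable_const y)
  have key : ∀ B : Set Ω, MeasurableSet B →
      x * μ.real B - y * ν.real B = ∫ z, B.indicator (fun z => x * g z - y) z ∂ν := by
    intro B hB
    have h1 : μ.real B = ∫ z in B, g z ∂ν := by
      rw [measureReal_def, hμ, withDensity_apply _ hB,
        ← ofReal_integral_eq_lintegral_ofReal hint.integrableOn (Filter.Eventually.of_forall hg0),
        ENNReal.toReal_ofReal (integral_nonneg hg0)]
    rw [integral_indicator hB, integral_sub (hint.integrableOn.const_mul x) (integrable_const y),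
      integral_const_mul, ← h1]
    simp [mul_comm]
  have hS : MeasurableSet {z | y < x * g z} := measurableSet_lt measurable_const (hg.const_mul x)
  rw [key A hA, key _ hS]
  refine integral_mono (hint'.indicator hA) (hint'.indicator hS) fun z => ?_
  by_cases h1 : z ∈ A <;> by_cases h2 : y < x * g z <;> simp [h1, h2] <;> linarith

/-- Two isotropic Gaussians whose means are at distance at most `r` are at most as
distinguishable as `N(1, (σ / r)²)` and `N(0, (σ / r)²)`. -/
theorem isoGaussian_sub_le {r : ℝ} (hσ : 0 < σ) (hr : 0 < r) {m m' : EuclideanSpace ℝ (Fin d)}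
    (hm : ‖m - m'‖ ≤ r) {x y : ℝ} (hx : 0 ≤ x) {A : Set (EuclideanSpace ℝ (Fin d))}
    (hA : MeasurableSet A) :
    x * (isoGaussian m σ).real A - y * (isoGaussian m' σ).real A
      ≤ gaussianHockey (σ / r) x y := by
  have hs : 0 < σ / r := by positivity
  refine (sub_le_of_withDensity (measurable_isoRatio m m' σ) (fun z => (Real.exp_pos _).le)
    (isoGaussian_eq_withDensity m m' hσ) x y hA).trans ?_
  rcases eq_or_ne m m' with rfl | hne
  · have h1 : ∀ z, isoRatio m m σ z = 1 := fun z => by simp [isoRatio]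
    simp only [h1, mul_one]
    by_cases hxy : y < x
    · simpa [hxy] using sub_le_gaussianHockey hs x y MeasurableSet.univ
    · simpa [hxy] using gaussianHockey_nonneg (σ / r) x y
  have hn : 0 < ‖m - m'‖ := norm_pos_iff.2 (sub_ne_zero.2 hne)
  -- the coordinate in which `m'` is the origin and `r` the unit of length
  set e : EuclideanSpace ℝ (Fin d) := (r * ‖m - m'‖)⁻¹ • (m - m') with he
  have hen : ‖e‖ = r⁻¹ := by
    rw [he, norm_smul, norm_inv, Real.norm_of_nonneg (by positivity)]
    field_simp
  set c : ℝ := inner ℝ e m'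
  have hem : inner ℝ e m - c = ‖m - m'‖ / r := by
    rw [← inner_sub_right, he, real_inner_smul_left, real_inner_self_eq_norm_sq]
    field_simp
  have hinner : ∀ z, inner ℝ (m - m') z = r * ‖m - m'‖ * inner ℝ e z := fun z => by
    rw [he, real_inner_smul_left]
    field_simp
  set U : Set ℝ := {t | y < x * Real.exp ((r * ‖m - m'‖ * t - ‖m - m'‖ ^ 2 / 2) / σ ^ 2)} with hU
  have hUm : MeasurableSet U := measurableSet_lt measurable_const (by fun_prop)
  have hset : {z | y < x * isoRatio m m' σ z} = (fun z => inner ℝ e z - c) ⁻¹' U := by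
    ext z
    simp only [isoRatio, hU, Set.mem_ofPred_eq, Set.mem_preimage, hinner]
    rw [← mul_sub]
  have hlaw : ∀ n : EuclideanSpace ℝ (Fin d),
      (isoGaussian n σ).real {z | y < x * isoRatio m m' σ z}
        = (gaussianReal (inner ℝ e n - c) ((σ / r) ^ 2).toNNReal).real U := by
    intro n
    have hv : σ ^ 2 * ‖e‖ ^ 2 = (σ / r) ^ 2 := by rw [hen]; field_simp
    rw [← gaussianReal_map_sub_const, ← hv, ← isoGaussian_map_inner,
      Measure.map_map (by fun_prop) (by fun_prop), map_measureReal_apply (by fun_prop) hUm, hset]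
    rfl
  -- `U` is an upper set, so moving the mean up to `1` increases its mass
  have hup : (gaussianReal (‖m - m'‖ / r) ((σ / r) ^ 2).toNNReal).real U
      ≤ (gaussian1 1 (σ / r)).real U := by
    have h1 : gaussian1 1 (σ / r) = (gaussianReal (‖m - m'‖ / r) ((σ / r) ^ 2).toNNReal).map
        (fun t => t + (1 - ‖m - m'‖ / r)) := by
      rw [gaussianReal_map_add_const, gaussian1]
      congr 1; ring
    rw [h1, map_measureReal_apply (by fun_prop) hUm]
    refine measureReal_mono fun t ht => ?_
    have h0 : 0 ≤ 1 - ‖m - m'‖ / r := by rw [sub_nonneg, div_le_one hr]; exact hm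
    simp only [hU, Set.mem_ofPred_eq, Set.mem_preimage] at ht ⊢
    refine ht.trans_le ?_
    gcongr
    linarith
  rw [hlaw, hlaw, hem, sub_self]
  refine le_trans ?_ (sub_le_gaussianHockey hs x y hUm)
  exact sub_le_sub_right (mul_le_mul_of_nonneg_left hup hx) _

end

/-! ### Poisson subsampling -/

section Sampling

variable {X : Type*} {q : ℝ}

/-- The expectation of `g T` over a Poisson subsample `T` of `D` with rate `q`. -/
noncomputable def sampleMean (q : ℝ) (D : Multiset X) (g : Multiset X → ℝ) : ℝ :=
  (D.powerset.map fun T => q ^ T.card * (1 - q) ^ (D.card - T.card) * g T).sum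

@[simp]
theorem sampleMean_zero (q : ℝ) (g : Multiset X → ℝ) : sampleMean q 0 g = g 0 := by
  simp [sampleMean]

theorem sampleMean_cons (q : ℝ) (a : X) (D : Multiset X) (g : Multiset X → ℝ) :
    sampleMean q (a ::ₘ D) g
      = q * sampleMean q D (fun T => g (a ::ₘ T)) + (1 - q) * sampleMean q D g := by
  simp only [sampleMean, Multiset.powerset_cons, Multiset.map_add, Multiset.sum_add,
    Multiset.map_map, Function.comp_def, Multiset.card_cons, ← Multiset.sum_map_mul_left]
  rw [add_comm]
  congr 2
  · refine Multiset.map_congr rfl fun T _ => ?_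
    rw [Nat.add_sub_add_right]
    ring
  · refine Multiset.map_congr rfl fun T hT => ?_
    rw [Nat.sub_add_comm (Multiset.card_le_card (Multiset.mem_powerset.1 hT))]
    ring

theorem sampleMean_add (q : ℝ) (C A : Multiset X) (g : Multiset X → ℝ) :
    sampleMean q (C + A) g = sampleMean q C fun T => sampleMean q A fun S => g (T + S) := by
  induction C using Multiset.induction generalizing g with
  | empty => simp
  | cons a C ih => simp only [Multiset.cons_add, sampleMean_cons, ih]

theorem sampleMean_sub_mul (q γ : ℝ) (D : Multiset X) (g h : Multiset X → ℝ) :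
    sampleMean q D g - γ * sampleMean q D h = sampleMean q D fun T => g T - γ * h T := by
  induction D using Multiset.induction generalizing g h with
  | empty => simp
  | cons a D ih => simp only [sampleMean_cons, ← ih]; ring

/-- The empty subsample, of probability `(1 - q) ^ |A|`, is kept exact and all others are bounded
by `M`. -/
theorem sampleMean_le (hq0 : 0 ≤ q) (hq1 : q ≤ 1) (A : Multiset X) {g : Multiset X → ℝ} {M : ℝ}
    (h : ∀ S ≤ A, g S ≤ M) :
    sampleMean q A g ≤ (1 - q) ^ A.card * g 0 + (1 - (1 - q) ^ A.card) * M := by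
  induction A using Multiset.induction generalizing g with
  | empty => simp
  | cons a A ih =>
    have h1 := ih fun S hS => h S (hS.trans (Multiset.le_cons_self A a))
    have h2 := ih (g := fun S => g (a ::ₘ S)) fun S hS => h _ ((Multiset.cons_le_cons_iff a).2 hS)
    have h3 : g (a ::ₘ 0) ≤ M := h _ ((Multiset.cons_le_cons_iff a).2 (Multiset.zero_le A))
    have h4 : (0 : ℝ) ≤ (1 - q) ^ A.card := pow_nonneg (by linarith) _
    have h5 : sampleMean q A (fun T => g (a ::ₘ T)) ≤ M := by nlinarith
    rw [sampleMean_cons, Multiset.card_cons, pow_succ]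
    calc _ ≤ q * M + (1 - q) * ((1 - q) ^ A.card * g 0 + (1 - (1 - q) ^ A.card) * M) :=
          add_le_add (mul_le_mul_of_nonneg_left h5 hq0)
            (mul_le_mul_of_nonneg_left h1 (by linarith))
      _ = _ := by ring

theorem le_sampleMean (hq0 : 0 ≤ q) (hq1 : q ≤ 1) (A : Multiset X) {g : Multiset X → ℝ} {N : ℝ}
    (h : ∀ S ≤ A, N ≤ g S) :
    (1 - q) ^ A.card * g 0 + (1 - (1 - q) ^ A.card) * N ≤ sampleMean q A g := by
  have h1 := sampleMean_le hq0 hq1 A (g := fun S => 0 - 1 * g S) (M := -N) fun S hS => by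
    linarith [h S hS]
  have h2 := sampleMean_sub_mul q 1 A (fun _ => 0) g
  have h3 : sampleMean q A (fun _ => (0 : ℝ)) = 0 := by simp [sampleMean]
  rw [h3] at h2
  linarith

theorem sampleMean_pos (hq0 : 0 ≤ q) (hq1 : q ≤ 1) (D : Multiset X) {g : Multiset X → ℝ}
    (h : ∀ S, 0 < g S) : 0 < sampleMean q D g := by
  induction D using Multiset.induction generalizing g with
  | empty => simpa using h 0
  | cons a D ih =>
    rw [sampleMean_cons]
    have h1 := ih h
    have h2 := ih (g := fun T => g (a ::ₘ T)) fun S => h _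
    rcases hq0.eq_or_lt with rfl | hq
    · simpa using h1
    · nlinarith [mul_pos hq h2, mul_nonneg (sub_nonneg.2 hq1) h1.le]

/-- Two subsampled means over different records `A` and `B` which agree on the empty subsample.
The mass `min u (γ v)` carried by the empty subsample on both sides cancels; what is left are
extreme values, attained at single subsamples. -/
theorem sampleMean_sub_le (hq0 : 0 ≤ q) (hq1 : q ≤ 1) {γ b : ℝ} (hγ : 0 ≤ γ)
    (A B : Multiset X) {g h : Multiset X → ℝ} (h0 : g 0 = h 0)
    (hb : ∀ S ≤ A, ∀ S' ≤ B,
      (1 - min ((1 - q) ^ A.card) (γ * (1 - q) ^ B.card)) * g S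
        - (γ - min ((1 - q) ^ A.card) (γ * (1 - q) ^ B.card)) * h S' ≤ b) :
    sampleMean q A g - γ * sampleMean q B h ≤ b := by
  classical
  obtain ⟨S, hS, hSmax⟩ := A.powerset.toFinset.exists_max_image g ⟨0, by simp⟩
  obtain ⟨S', hS', hSmin⟩ := B.powerset.toFinset.exists_min_image h ⟨0, by simp⟩
  simp only [Multiset.mem_toFinset, Multiset.mem_powerset] at hS hSmax hS' hSmin
  have h1 := sampleMean_le hq0 hq1 A hSmax
  have h2 := mul_le_mul_of_nonneg_left (le_sampleMean hq0 hq1 B hSmin) hγ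
  have h3 := hb S hS S' hS'
  have h4 := hSmax 0 (Multiset.zero_le A)
  have h5 := hSmin 0 (Multiset.zero_le B)
  set u := (1 - q) ^ A.card
  set v := (1 - q) ^ B.card
  rw [h0] at h1 h4
  rcases le_total u (γ * v) with huv | huv
  · rw [min_eq_left huv] at h3
    nlinarith [mul_nonneg (sub_nonneg.2 huv) (sub_nonneg.2 h5)]
  · rw [min_eq_right huv] at h3
    nlinarith [mul_nonneg (sub_nonneg.2 huv) (sub_nonneg.2 h4)]

end Sampling

/-! ### The subsampled Gaussian mechanism -/

section Mechanism

variable {X : Type*} {d : ℕ} {f : Multiset X → EuclideanSpace ℝ (Fin d)} {q σ : ℝ}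

theorem isFiniteMeasure_and_real_multiset_sum {Ω ι : Type*} [MeasurableSpace Ω] {c : ι → ℝ}
    (hc : ∀ T, 0 ≤ c T) (μ : ι → Measure Ω) [∀ T, IsFiniteMeasure (μ T)] (W : Multiset ι) :
    IsFiniteMeasure (W.map fun T => ENNReal.ofReal (c T) • μ T).sum ∧
      ∀ s, (W.map fun T => ENNReal.ofReal (c T) • μ T).sum.real s
        = (W.map fun T => c T * (μ T).real s).sum := by
  induction W using Multiset.induction with
  | empty =>
    simp only [Multiset.map_zero, Multiset.sum_zero]
    exact ⟨inferInstance, fun s => by simp⟩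
  | cons T W ih =>
    obtain ⟨hfin, hreal⟩ := ih
    have : IsFiniteMeasure (ENNReal.ofReal (c T) • μ T) :=
      Measure.smul_finite _ ENNReal.ofReal_ne_top
    simp only [Multiset.map_cons, Multiset.sum_cons]
    refine ⟨inferInstance, fun s => ?_⟩
    rw [measureReal_add_apply, hreal, measureReal_ennreal_smul_apply, ENNReal.toReal_ofReal (hc T)]

theorem weight_nonneg (hq0 : 0 ≤ q) (hq1 : q ≤ 1) (D T : Multiset X) :
    0 ≤ q ^ T.card * (1 - q) ^ (D.card - T.card) :=
  mul_nonneg (pow_nonneg hq0 _) (pow_nonneg (by linarith) _)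

theorem isFiniteMeasure_mechanism (f : Multiset X → EuclideanSpace ℝ (Fin d)) (σ : ℝ)
    (hq0 : 0 ≤ q) (hq1 : q ≤ 1) (D : Multiset X) :
    IsFiniteMeasure (mechanism f q σ D) :=
  (isFiniteMeasure_and_real_multiset_sum (weight_nonneg hq0 hq1 D) _ _).1

theorem mechanism_real (f : Multiset X → EuclideanSpace ℝ (Fin d)) (σ : ℝ)
    (hq0 : 0 ≤ q) (hq1 : q ≤ 1) (D : Multiset X) (s : Set (EuclideanSpace ℝ (Fin d))) :
    (mechanism f q σ D).real s = sampleMean q D fun T => (isoGaussian (f T) σ).real s :=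
  (isFiniteMeasure_and_real_multiset_sum (weight_nonneg hq0 hq1 D) _ _).2 s

theorem mechanism_absolutelyContinuous (hq0 : 0 ≤ q) (hq1 : q ≤ 1) (hσ : 0 < σ)
    (D D' : Multiset X) : mechanism f q σ D ≪ mechanism f q σ D' := by
  have := isFiniteMeasure_mechanism f σ hq0 hq1
  intro s hs
  rw [← measureReal_eq_zero_iff, mechanism_real f σ hq0 hq1] at hs ⊢
  have h0 : ∃ T, (isoGaussian (f T) σ).real s = 0 := by
    by_contra! hne
    exact (sampleMean_pos hq0 hq1 D' fun T => measureReal_nonneg.lt_of_ne' (hne T)).ne' hs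
  obtain ⟨T, hT⟩ := h0
  rw [measureReal_eq_zero_iff] at hT
  have h1 : ∀ S, (isoGaussian (f S) σ).real s = 0 := fun S => by
    rw [measureReal_eq_zero_iff]
    exact isoGaussian_absolutelyContinuous (f S) (f T) hσ hT
  simp [sampleMean, h1]

variable [DecidableEq X]

theorem SensitivityLE.norm_add_sub_le (hf : SensitivityLE f 1) (T S : Multiset X) :
    ‖f (T + S) - f T‖ ≤ S.card := by
  induction S using Multiset.induction with
  | empty => simp
  | cons a S ih =>
    have h1 : ‖f (T + a ::ₘ S) - f (T + S)‖ ≤ 1 := by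
      refine hf _ _ ?_
      rw [Multiset.add_cons, datasetDist, ← Multiset.singleton_add, add_tsub_cancel_right,
        tsub_eq_zero_of_le (le_add_of_nonneg_left (zero_le (a := ({a} : Multiset X))))]
      simp
    have := norm_sub_le_norm_sub_add_norm_sub (f (T + a ::ₘ S)) (f (T + S)) (f T)
    rw [Multiset.card_cons]
    push_cast
    linarith

/-- Conditionally on the subsample `T` of the common records `C`, every mean of one mechanism is
within `|A| + |B| ≤ r` of every mean of the other, and both mechanisms release `N(f T, σ² I)` when
no private record is kept. -/
theorem mechanism_sub_le (hf : SensitivityLE f 1) (hq0 : 0 ≤ q) (hq1 : q ≤ 1) (hσ : 0 < σ)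
    {r : ℕ} (hr : 1 ≤ r) (C A B : Multiset X) (hAB : A.card + B.card ≤ r) {γ : ℝ} (hγ : 0 ≤ γ)
    {s : Set (EuclideanSpace ℝ (Fin d))} (hs : MeasurableSet s) :
    (mechanism f q σ (C + A)).real s - γ * (mechanism f q σ (C + B)).real s
      ≤ gaussianHockey (σ / r) (1 - min ((1 - q) ^ A.card) (γ * (1 - q) ^ B.card))
          (γ - min ((1 - q) ^ A.card) (γ * (1 - q) ^ B.card)) := by
  have hr0 : (0 : ℝ) < r := by exact_mod_cast hr
  rw [mechanism_real f σ hq0 hq1, mechanism_real f σ hq0 hq1, sampleMean_add, sampleMean_add,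
    sampleMean_sub_mul]
  set b := gaussianHockey (σ / r) (1 - min ((1 - q) ^ A.card) (γ * (1 - q) ^ B.card))
          (γ - min ((1 - q) ^ A.card) (γ * (1 - q) ^ B.card))
  have key : ∀ T : Multiset X, sampleMean q A (fun S => (isoGaussian (f (T + S)) σ).real s)
      - γ * sampleMean q B (fun S => (isoGaussian (f (T + S)) σ).real s) ≤ b := fun T => by
    refine sampleMean_sub_le hq0 hq1 hγ A B rfl fun S hS S' hS' => ?_
    refine isoGaussian_sub_le hσ hr0 ?_ ?_ hs
    · have h1 := hf.norm_add_sub_le T S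
      have h2 := hf.norm_add_sub_le T S'
      have h3 := norm_sub_le_norm_sub_add_norm_sub (f (T + S)) (f T) (f (T + S'))
      rw [norm_sub_rev (f T)] at h3
      have h4 : (S.card + S'.card : ℝ) ≤ r := by
        exact_mod_cast (add_le_add (Multiset.card_le_card hS) (Multiset.card_le_card hS')).trans hAB
      linarith
    · have : (1 - q) ^ A.card ≤ 1 := pow_le_one₀ (by linarith) (by linarith)
      linarith [min_le_left ((1 - q) ^ A.card) (γ * (1 - q) ^ B.card)]
  have := sampleMean_le hq0 hq1 C (M := b) fun T _ => key T
  have h0 : (0 : ℝ) ≤ (1 - q) ^ C.card := pow_nonneg (by linarith) _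
  nlinarith [key 0]

end Mechanism

/-! ### Comparison with the one-dimensional mixture -/

theorem gaussianMix_eq_withDensity {w s : ℝ} (hs : 0 < s) (hw0 : 0 ≤ w) (hw1 : w ≤ 1) :
    gaussianMix (1 - w) s = (gaussian1 0 s).withDensity fun z =>
      ENNReal.ofReal (w + (1 - w) * likelihoodRatio s z) := by
  have h : (fun z => ENNReal.ofReal (w + (1 - w) * likelihoodRatio s z))
      = (fun _ => ENNReal.ofReal w)
        + ENNReal.ofReal (1 - w) • fun z => ENNReal.ofReal (likelihoodRatio s z) := by
    ext z
    have := likelihoodRatio_pos s z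
    rw [ENNReal.ofReal_add hw0 (mul_nonneg (by linarith) this.le),
      ENNReal.ofReal_mul (by linarith)]
    rfl
  rw [h, withDensity_add_left measurable_const, withDensity_const,
    withDensity_smul _ (by fun_prop), ← gaussian1_one_eq hs, gaussianMix, sub_sub_cancel]

instance (p s : ℝ) : IsFiniteMeasure (gaussianMix p s) := by
  have := Measure.smul_finite (gaussian1 0 s) (ENNReal.ofReal_ne_top (r := 1 - p))
  have := Measure.smul_finite (gaussian1 1 s) (ENNReal.ofReal_ne_top (r := p))
  unfold gaussianMix
  infer_instance

theorem hockeyStick_gaussianMix {w s : ℝ} (hs : 0 < s) (hw0 : 0 ≤ w) (hw1 : w ≤ 1) {γ : ℝ}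
    (hγ : 0 ≤ γ) :
    hockeyStick (gaussianMix (1 - w) s) (gaussian1 0 s) γ
      = ENNReal.ofReal (gaussianHockey s (1 - w) (γ - w)) := by
  rw [gaussianHockey, ofReal_integral_eq_lintegral_ofReal (integrable_hockey s _ _)
    (Filter.Eventually.of_forall fun _ => le_max_right _ _), hockeyStick,
    gaussianMix_eq_withDensity hs hw0 hw1]
  refine lintegral_congr_ae ?_
  filter_upwards [Measure.rnDeriv_withDensity (gaussian1 0 s)
    (f := fun z => ENNReal.ofReal (w + (1 - w) * likelihoodRatio s z)) (by fun_prop)] with z hz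
  rw [hz, ← ENNReal.ofReal_sub _ hγ, ENNReal.ofReal_max, ENNReal.ofReal_zero, max_eq_left (by simp)]
  congr 1
  ring

/-- The divergence is bounded by that of the mixture relative to the single Gaussian, whichever of
the two datasets comes first. -/
theorem renyiDiv_mechanism_le {X : Type*} [DecidableEq X] {d : ℕ}
    {f : Multiset X → EuclideanSpace ℝ (Fin d)} (hf : SensitivityLE f 1) {q : ℝ} (hq0 : 0 ≤ q)
    (hq1 : q ≤ 1) {σ : ℝ} (hσ : 0 < σ) {r : ℕ} (hr : 1 ≤ r) {D D' : Multiset X}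
    (hD : datasetDist D D' ≤ r) {α : ℝ} (hα : 1 < α) :
    renyiDiv α (mechanism f q σ D) (mechanism f q σ D')
      ≤ renyiDiv α (gaussianMix (1 - (1 - q) ^ r) (σ / r)) (gaussian1 0 (σ / r)) := by
  have hs : 0 < σ / r := div_pos hσ (by exact_mod_cast hr)
  have hfin := isFiniteMeasure_mechanism f σ hq0 hq1
  have hac := mechanism_absolutelyContinuous (f := f) hq0 hq1 hσ D D'
  have hp : ∀ n : ℕ, 0 ≤ (1 - q) ^ n ∧ (1 - q) ^ n ≤ 1 := fun n =>
    ⟨pow_nonneg (by linarith) _, pow_le_one₀ (by linarith) (by linarith)⟩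
  have hw : (1 - q) ^ r ≤ (1 - q) ^ (D - D').card * (1 - q) ^ (D' - D).card := by
    rw [← pow_add]
    exact pow_le_pow_of_le_one (by linarith) (by linarith) hD
  have hle : ∀ γ : ℝ, 0 ≤ γ → hockeyStick (mechanism f q σ D) (mechanism f q σ D') γ
      ≤ ENNReal.ofReal (gaussianHockey (σ / r)
          (1 - min ((1 - q) ^ (D - D').card) (γ * (1 - q) ^ (D' - D).card))
          (γ - min ((1 - q) ^ (D - D').card) (γ * (1 - q) ^ (D' - D).card))) := fun γ hγ => by
    refine hockeyStick_le_ofReal hac hγ fun s hs => ?_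
    have h := mechanism_sub_le hf hq0 hq1 hσ hr (D ∩ D') (D - D') (D' - D) hD hγ hs
    have e : D ∩ D' + (D - D') = D := by rw [add_comm, Multiset.sub_add_inter]
    have e' : D ∩ D' + (D' - D) = D' := by
      rw [add_comm, Multiset.inter_comm, Multiset.sub_add_inter]
    rwa [e, e'] at h
  refine renyiDiv_le_of_hockeyStick_le hα hac (fun γ hγ => ?_) fun γ hγ => ?_
  · rw [hockeyStick_gaussianMix hs (hp r).1 (hp r).2 (by linarith)]
    exact (hle γ (by linarith)).trans (ENNReal.ofReal_le_ofReal
      (gaussianHockey_min_le _ (hp _).1 (hp _).2 hw (hp _).2 hγ (hp _).1))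
  · have hi : 0 ≤ γ⁻¹ := inv_nonneg.2 (by linarith)
    rw [hockeyStick_gaussianMix hs (hp r).1 (hp r).2 (by linarith),
      hockeyStick_gaussianMix hs (hp r).1 (hp r).2 hi,
      ← ENNReal.ofReal_add (gaussianHockey_nonneg _ _ _) (gaussianHockey_nonneg _ _ _)]
    refine (add_le_add (hle γ (by linarith)) (hle γ⁻¹ hi)).trans ?_
    rw [← ENNReal.ofReal_add (gaussianHockey_nonneg _ _ _) (gaussianHockey_nonneg _ _ _)]
    exact ENNReal.ofReal_le_ofReal
      (gaussianHockey_min_add_le hs (hp _).1 (hp _).2 (hp _).1 (hp _).2 hw hγ)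

end SGM

theorem mainTheorem7 {X : Type*} [DecidableEq X] {d : ℕ}
    (f : Multiset X → EuclideanSpace ℝ (Fin d)) (hf : SGM.SensitivityLE f 1)
    (q : ℝ) (hq0 : 0 ≤ q) (hq1 : q ≤ 1) (σ : ℝ) (hσ : 0 < σ)
    (r : ℕ) (hr : 1 ≤ r) (D₁ D₃ : Multiset X) (hD : D₃ ∈ SGM.datasetBall D₁ r)
    (α : ℝ) (hα : 1 < α) :
    SGM.renyiDiv α (SGM.mechanism f q σ D₁) (SGM.mechanism f q σ D₃)
        ≤ SGM.SG α (1 - (1 - q) ^ r) (σ / r) ∧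
      SGM.renyiDiv α (SGM.mechanism f q σ D₃) (SGM.mechanism f q σ D₁)
        ≤ SGM.SG α (1 - (1 - q) ^ r) (σ / r) := by
  have hD' : SGM.datasetDist D₁ D₃ ≤ r := hD
  have hD'' : SGM.datasetDist D₃ D₁ ≤ r := by
    rwa [SGM.datasetDist, add_comm]
  exact ⟨(SGM.renyiDiv_mechanism_le hf hq0 hq1 hσ hr hD' hα).trans (le_max_right _ _),
    (SGM.renyiDiv_mechanism_le hf hq0 hq1 hσ hr hD'' hα).trans (le_max_right _ _)⟩
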